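/- Let $k$ be a field of characteristic $0$, let $n\in\mathbb Z$, and let $L$ be a formal moduli problem over $k$, presented by an $L_\infty$ algebra $\mathfrak l=\mathbb T_o[-1]L$ that is finite dimensional as a vector space. The $L_\infty$ structure is given by its cohomological vector field $Q_{\mathfrak l}$: a derivation of cohomological degree $1$ of $\mathcal O(L)=\widehat{\mathrm{Sym}}{}^\bullet(\mathfrak l^*[-1])$ with vanishing constant term and $Q_{\mathfrak l}^2=0$. Let $x_i$ be the linear coordinates on $\mathfrak l[1]$ dual to a homogeneous basis. The $(n-1)$-shifted polyvector fields on $L$ form the graded commutative algebra $$\Gamma(L,\widehat{\mathrm{Sym}}{}^\bullet(\mathbb T_L[-n]))=\widehat{\mathrm{Sym}}{}^\bullet(\mathfrak l^*[-1]\oplus\mathfrak l[1-n])=\mathcal O(T^*[n]L)$$ of power series in the $x_i$ and in the symbols $p_i=\partial/\partial x_i$ of degree $n-|x_i|$, with the Schouten bracket $[\cdot,\cdot]$ of degree $-n$; a vector field $\sum_i X^i\,\partial/\partial x_i$ on $L$ is identified with $\sum_i X^i p_i$. Let $Q_{T^*[n]L}$ be the cohomological vector field of the $L_\infty$ algebra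 $\mathbb T_o[-1](T^*[n]L)=\mathfrak l\ltimes\mathfrak l^*[n-2]$, that is, the derivation of $\mathcal O(T^*[n]L)$ which acts on $\mathcal O(L)$ by $Q_{\mathfrak l}$ and on sections of $\mathbb T_L$ by $\mathcal L_{Q_{\mathfrak l}}=[Q_{\mathfrak l},\cdot]$. For a function $F$ on $T^*[n]L$ let $Q_F$ be its Hamiltonian vector field for the canonical $n$-shifted symplectic structure on $T^*[n]L$. Let $\bar\Pi=\{\Pi_j\}_{j\ge 2}\in\prod_{j\ge2}\Gamma(L,\mathrm{Sym}^j(\mathbb T_L[-n]))$ be a polyvector field of cohomological degree $n+1$. Then the degree $1$ vector field $Q_{T^*[n]L}+Q_{\bar\Pi}$ on $T^*[n]L$ satisfies $(Q_{T^*[n]L}+Q_{\bar\Pi})^2=0$ if and only if $\bar\Pi$ is an $(n-1)$-shifted homotopy Poisson structure on $L$, i.e. $$[Q_{\mathfrak l}+\bar\Pi,\;Q_{\mathfrak l}+\bar\Pi]=0 .$$ In that case $Q_{T^*[n]L}+Q_{\bar\Pi}$ is the cohomological vector field (of degree $1$, with vanishing constant term and square zero) of an $L_\infty$ algebra structure on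 the graded vector space $\mathfrak l\oplus\mathfrak l^*[n-2]$, hence defines a formal moduli problem $T^*_{\bar\Pi}[n]L$, the twisted cotangent bundle or higher Poisson centre of $(L,\bar\Pi)$. This vector field is symplectic for the canonical $n$-shifted symplectic structure (it is a derivation of the Poisson bracket), and the zero section is a map $\sigma_0:L\to T^*_{\bar\Pi}[n]L$ of formal moduli problems: restriction of functions along it intertwines $Q_{T^*[n]L}+Q_{\bar\Pi}$ with $Q_{\mathfrak l}$. -/

import Mathlib

/-!
Formal moduli problems over a field `k` of characteristic zero are described by their
`(-1)`-shifted tangent `L∞` algebra `𝔤`, finite dimensional as a vector space.  The graded vector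
space `𝔤` is given by a finite index set `σ` of a homogeneous basis `e_s` and the function
`deg : σ → ℤ` of the cohomological degrees of the `e_s`.
-/

namespace FormalModuli

section Functions

variable (k : Type*) [Field k] {σ : Type*} (deg : σ → ℤ)

/-- The degree of the linear coordinate `x_s ∈ 𝔤^*[-1]` dual to `e_s`. -/
def coordDeg (s : σ) : ℤ := 1 - deg s

/-- The degree of the monomial `x_{s₁} ⋯ x_{sₘ}`. -/
def wordDeg (w : List σ) : ℤ := (w.map (coordDeg deg)).sum

/-- The graded vector space underlying `𝒪(X) = ∏ₘ Symᵐ(𝔤^*[-1])`.  A formal power series `f` in the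
graded commuting variables `x_s` is recorded by all its Taylor coefficients
`f [s₁, …, sₘ] = (∂_{sₘ} ⋯ ∂_{s₁} f)(0)` (left derivatives), that is, by the sequence of graded
symmetric `m`-linear forms on `𝔤[1]`, evaluated on basis vectors. -/
def Functions : Submodule k (List σ → k) where
  carrier := {f | ∀ (u v : List σ) (a b : σ),
    f (u ++ a :: b :: v) = (-1) ^ (coordDeg deg a * coordDeg deg b) * f (u ++ b :: a :: v)}
  add_mem' := by
    intro f g hf hg u v a b
    simp only [Pi.add_apply, hf u v a b, hg u v a b, mul_add]
  zero_mem' := by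
    intro u v a b
    simp
  smul_mem' := by
    intro c f hf u v a b
    simp only [Pi.smul_apply, smul_eq_mul, hf u v a b]
    ring

/-- `f` is homogeneous of cohomological degree `m`. -/
def IsHomogeneous (f : Functions k deg) (m : ℤ) : Prop :=
  ∀ w : List σ, f.1 w ≠ 0 → wordDeg deg w = m

/-- The product of two power series in terms of Taylor coefficients; the recursion is the graded
Leibniz rule `∂_s (f g) = (∂_s f) g + (-1)^{|x_s| |f|} f (∂_s g)`. -/
def mulWord : List σ → (List σ → k) → (List σ → k) → k
  | [], f, g => f [] * g []
  | s :: w, f, g =>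
      mulWord w (fun u => f (s :: u)) g +
        mulWord w (fun u => (-1) ^ (coordDeg deg s * wordDeg deg u) * f u) (fun u => g (s :: u))

variable {k}

theorem wordDeg_swap (u v : List σ) (a b : σ) :
    wordDeg deg (u ++ a :: b :: v) = wordDeg deg (u ++ b :: a :: v) := by
  simp only [wordDeg, List.map_append, List.map_cons, List.sum_append, List.sum_cons]
  ring

theorem mulWord_smul_left (c : k) (w : List σ) (f g : List σ → k) :
    mulWord k deg w (fun u => c * f u) g = c * mulWord k deg w f g := by
  induction w generalizing f g with
  | nil => simp only [mulWord]; ring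
  | cons s w ih =>
    have h : (fun u => (-1 : k) ^ (coordDeg deg s * wordDeg deg u) * (c * f u)) =
        fun u => c * ((-1 : k) ^ (coordDeg deg s * wordDeg deg u) * f u) := by
      funext u; ring
    simp only [mulWord]
    rw [h, ih, ih]
    ring

theorem mulWord_smul_right (c : k) (w : List σ) (f g : List σ → k) :
    mulWord k deg w f (fun u => c * g u) = c * mulWord k deg w f g := by
  induction w generalizing f g with
  | nil => simp only [mulWord]; ring
  | cons s w ih =>
    simp only [mulWord]
    rw [ih, ih]
    ring

theorem cons_mem {f : List σ → k} (hf : f ∈ Functions k deg) (s : σ) :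
    (fun u => f (s :: u)) ∈ Functions k deg := by
  intro u v a b
  exact hf (s :: u) v a b

theorem twist_mem {f : List σ → k} (hf : f ∈ Functions k deg) (m : ℤ) :
    (fun u => (-1) ^ (m * wordDeg deg u) * f u) ∈ Functions k deg := by
  intro u v a b
  simp only
  rw [hf u v a b, wordDeg_swap]
  ring

theorem mul_mem {f g : List σ → k} (hf : f ∈ Functions k deg) (hg : g ∈ Functions k deg) :
    (fun w => mulWord k deg w f g) ∈ Functions k deg := by
  intro u v a b
  induction u generalizing f g with
  | nil =>
    have sq : ∀ m : ℤ, ((-1 : k) ^ m) * (-1) ^ m = 1 := by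
      intro m
      rw [← mul_zpow]; simp
    have h1 : (fun u => f (a :: b :: u)) =
        fun u => (-1 : k) ^ (coordDeg deg a * coordDeg deg b) * f (b :: a :: u) := by
      funext u; exact hf [] u a b
    have h2 : (fun u => g (a :: b :: u)) =
        fun u => (-1 : k) ^ (coordDeg deg a * coordDeg deg b) * g (b :: a :: u) := by
      funext u; exact hg [] u a b
    have h3 : ∀ (s t : σ), (fun u => (-1 : k) ^ (coordDeg deg s * wordDeg deg (t :: u)) *
        f (t :: u)) = fun u => (-1 : k) ^ (coordDeg deg s * coordDeg deg t) *
          ((-1 : k) ^ (coordDeg deg s * wordDeg deg u) * f (t :: u)) := by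
      intro s t
      funext u
      have : wordDeg deg (t :: u) = coordDeg deg t + wordDeg deg u := by simp [wordDeg]
      rw [this, mul_add, zpow_add₀ (by norm_num)]
      ring
    have h4 : (fun u => (-1 : k) ^ (coordDeg deg b * wordDeg deg u) *
          ((-1 : k) ^ (coordDeg deg a * wordDeg deg u) * f u)) =
        (fun u => (-1 : k) ^ (coordDeg deg a * wordDeg deg u) *
          ((-1 : k) ^ (coordDeg deg b * wordDeg deg u) * f u)) := by
      funext u; ring
    simp only [List.nil_append, mulWord]
    rw [h1, h2, h3 a b, h3 b a, h4]
    simp only [mulWord_smul_left, mulWord_smul_right]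
    rw [mul_comm (coordDeg deg b) (coordDeg deg a)]
    have e := sq (coordDeg deg a * coordDeg deg b)
    linear_combination (- mulWord k deg v
      (fun u => (-1 : k) ^ (coordDeg deg b * wordDeg deg u) * f (a :: u))
      (fun u => g (b :: u))) * e
  | cons s u ih =>
    simp only [List.cons_append, mulWord]
    have h1 := ih (cons_mem deg hf s) hg
    have h2 := ih (twist_mem deg hf (coordDeg deg s)) (cons_mem deg hg s)
    simp only at h1 h2
    rw [h1, h2]
    ring

/-- The graded commutative product of `𝒪(X)`. -/
instance : Mul (Functions k deg) :=
  ⟨fun f g => ⟨fun w => mulWord k deg w f.1 g.1, mul_mem deg f.2 g.2⟩⟩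

/-- The constant function `1`. -/
def one [DecidableEq σ] : Functions k deg :=
  ⟨fun w => if w = [] then 1 else 0, by intro u v a b; simp⟩

/-- The coordinate function `x_s`. -/
def coord [DecidableEq σ] (s : σ) : Functions k deg :=
  ⟨fun w => if w = [s] then 1 else 0, by
    intro u v a b
    have h : ∀ c d : σ, u ++ c :: d :: v ≠ [s] := by
      intro c d h
      have := congrArg List.length h
      simp only [List.length_append, List.length_cons, List.length_nil] at this
      omega
    simp [h]⟩

/-- The left derivative `∂f/∂x_s`. -/
def lderiv (s : σ) (f : Functions k deg) : Functions k deg :=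
  ⟨fun w => f.1 (s :: w), cons_mem deg f.2 s⟩

/-- The right derivative of `f` by `x_s`, which on homogeneous `f` is
`(-1)^{|x_s| (|f| + 1)} ∂f/∂x_s`. -/
def rderiv (s : σ) (f : Functions k deg) : Functions k deg :=
  ⟨fun w => f.1 (w ++ [s]), by
    intro u v a b
    simpa using f.2 u (v ++ [s]) a b⟩

end Functions

section VectorFields

variable (k : Type*) [Field k] {σ : Type*} (deg : σ → ℤ)

/-- `Γ(X, T_X) = 𝒪(X) ⊗ 𝔤[1]`: the vector field `∑_s X^s ∂/∂x_s` is the family of its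
components `X^s`. -/
abbrev VectorField := σ → Functions k deg

variable {k}

/-- `X` has cohomological degree `m` as a derivation of `𝒪(X)`. -/
def VectorField.HasDegree (X : VectorField k deg) (m : ℤ) : Prop :=
  ∀ s, IsHomogeneous k deg (X s) (coordDeg deg s + m)

/-- The action `X(f) = ∑_s X^s ∂f/∂x_s` of vector fields on functions. -/
def VectorField.apply [Fintype σ] (X : VectorField k deg) (f : Functions k deg) :
    Functions k deg :=
  ∑ s, X s * lderiv deg s f

/-- `X² = 0` as an endomorphism of `𝒪(X)`. -/
def VectorField.SquareZero [Fintype σ] (X : VectorField k deg) : Prop :=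
  ∀ f : Functions k deg, X.apply deg (X.apply deg f) = 0

/-- The coordinate vector field `∂/∂x_s`, of degree `-|x_s|`. -/
def coordField [DecidableEq σ] (s : σ) : VectorField k deg :=
  fun t => if t = s then one deg else 0

/-- The graded commutator `[X, Y] = X Y - (-1)^{|X| |Y|} Y X` of vector fields of degrees `m`
and `m'`. -/
def lieBracket [Fintype σ] (m m' : ℤ) (X Y : VectorField k deg) : VectorField k deg :=
  fun s => X.apply deg (Y s) - (-1 : k) ^ (m * m') • Y.apply deg (X s)

variable (k)

/-- An `L∞` algebra structure on the graded vector space `𝔤` with homogeneous basis of degrees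
`deg` (equivalently, a formal moduli problem with shifted tangent complex `𝔤`), given by its
cohomological vector field.  The Taylor coefficients of `Q` of order `m` are the structure constants
of the bracket `l_m`; there is no curvature `l_0`; and `Q² = 0` is the system of generalized Jacobi
identities. -/
structure LInftyAlgebra [Fintype σ] where
  /-- the cohomological vector field `Q_𝔤` -/
  Q : VectorField k deg
  hasDegree : Q.HasDegree deg 1
  noCurvature : ∀ s, (Q s).1 [] = 0
  squareZero : Q.SquareZero deg

end VectorFields

section Cotangent

variable {k : Type*} [Field k] {ι : Type*} (n : ℤ) (deg : ι → ℤ)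

/-- The degrees of the basis `e_i`, `e^i` of `𝔩 ⊕ 𝔩^*[n-2]`, the shifted tangent complex of
`T^*[n]L`.  The coordinate `x_i` dual to `e_i` is indexed by `Sum.inl i`.  The coordinate dual to
`e^i` is indexed by `Sum.inr i`; it has degree `n - |x_i|` and is written `p_i`. -/
def cotangentDeg : ι ⊕ ι → ℤ := Sum.elim deg (fun i => 2 - n - deg i)

variable (k) in
/-- `𝒪(T^*[n]L)`, as a graded algebra, is the algebra `Γ(L, Sym^(T_L[-n]))` of `(n-1)`-shifted
polyvector fields on `L`: power series in the `x_i` and in the symbols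
`p_i = ∂/∂x_i ∈ Γ(L, T_L[-n])`. -/
abbrev PolyVector := Functions k (cotangentDeg n deg)

/-- `F` has components only in `Sym^j(T_L[-n])` with `j ≥ r`. -/
def MixedDegreeGE (F : PolyVector k n deg) (r : ℕ) : Prop :=
  ∀ w : List (ι ⊕ ι), F.1 w ≠ 0 → r ≤ w.countP Sum.isRight

/-- Pullback of functions along the projection `T^*[n]L → L`. -/
def pullback (f : Functions k deg) : PolyVector k n deg :=
  ⟨fun w => if w.all Sum.isLeft then f.1 (w.filterMap Sum.getLeft?) else 0, by
    intro u v a b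
    rcases a with a | a <;> rcases b with b | b
    · simp only [List.all_append, List.all_cons, Sum.isLeft_inl, Bool.true_and,
        List.filterMap_append, List.filterMap_cons, Sum.getLeft?_inl]
      split_ifs
      · exact f.2 _ _ a b
      · simp
    all_goals simp⟩

/-- Restriction of functions on `T^*[n]L` along the zero section `σ₀ : L → T^*[n]L`. -/
def zeroSection (F : PolyVector k n deg) : Functions k deg :=
  ⟨fun w => F.1 (w.map Sum.inl), by
    intro u v a b
    simpa [coordDeg, cotangentDeg] using F.2 (u.map Sum.inl) (v.map Sum.inl) (Sum.inl a) (Sum.inl b)⟩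

variable [Fintype ι] [DecidableEq ι]

/-- The polyvector field `∑_i X^i p_i` given by a vector field `X = ∑_i X^i ∂/∂x_i` on `L`. -/
def ofVectorField (X : VectorField k deg) : PolyVector k n deg :=
  ∑ i, pullback n deg (X i) * coord (cotangentDeg n deg) (Sum.inr i)

/-- The vector field on `T^*[n]L` defining the `L∞` structure on `𝔩 ⋉ 𝔩^*[n-2]`, for `Q = Q_𝔩`.
As `T^*[n]L` is the total space of the bundle dual to `T_L[-n]`, it is the derivation of
`Γ(L, Sym^(T_L[-n]))` that acts on `𝒪(L)` by `Q` and on sections of `T_L` by the Chevalley-Eilenberg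
differential `ℒ_Q = [Q, ·]`; thus `x_i ↦ Q(x_i)` and `p_j ↦ [Q, ∂/∂x_j]`. -/
def cotangentField (Q : VectorField k deg) : VectorField k (cotangentDeg n deg) :=
  Sum.elim (fun i => pullback n deg (Q i))
    (fun j => ofVectorField n deg (lieBracket deg 1 (-coordDeg deg j) Q (coordField deg j)))

/-- The Schouten bracket of `(n-1)`-shifted polyvector fields, of cohomological degree `-n`: with
right derivatives of `F` and left derivatives of `G`,
`[F, G] = ∑_i (F ∂/∂p_i) (∂/∂x_i G) - (-1)^{(n+1)|x_i|} (F ∂/∂x_i) (∂/∂p_i G)`.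
It is the biderivation with `[X, f] = X(f)` and `[X, Y]` the commutator for vector fields `X`, `Y`
and functions `f` on `L`. -/
def schouten (F G : PolyVector k n deg) : PolyVector k n deg :=
  ∑ i, (rderiv _ (Sum.inr i) F * lderiv _ (Sum.inl i) G -
    (-1 : k) ^ ((n + 1) * coordDeg deg i) • (rderiv _ (Sum.inl i) F * lderiv _ (Sum.inr i) G))

variable (k) in
/-- The Poisson tensor inverse to the canonical constant coefficient `n`-shifted symplectic
form on `T^*[n]L`, the duality pairing of `𝔩` and `𝔩^*[n-2]`: `{p_i, x_i} = 1` and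
`{x_i, p_i} = -(-1)^{(n+1)|x_i|}`. -/
def poissonTensor : ι ⊕ ι → ι ⊕ ι → k
  | Sum.inr i, Sum.inl j => if i = j then 1 else 0
  | Sum.inl i, Sum.inr j => if i = j then -(-1) ^ ((n + 1) * coordDeg deg i) else 0
  | _, _ => 0

/-- The Hamiltonian vector field `Q_F` on `T^*[n]L`: the Poisson tensor contracted with the de Rham
differential of `F`.  It has degree `|F| - n`. -/
def hamiltonianField (F : PolyVector k n deg) : VectorField k (cotangentDeg n deg) :=
  fun t => ∑ s, poissonTensor k n deg s t • rderiv _ s F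

/-- The Poisson bracket `{F, G} = Q_F(G)` of functions on `T^*[n]L`. -/
def poissonBracket (F G : PolyVector k n deg) : PolyVector k n deg :=
  (hamiltonianField n deg F).apply _ G

/-- A degree one vector field `Q` on `T^*[n]L` is symplectic (`ℒ_Q ω = 0`), that is, it is a
derivation of the Poisson bracket. -/
def IsSymplectic (Q : VectorField k (cotangentDeg n deg)) : Prop :=
  ∀ (m : ℤ) (F G : PolyVector k n deg), IsHomogeneous k _ F m →
    Q.apply _ (poissonBracket n deg F G) =
      poissonBracket n deg (Q.apply _ F) G +
        (-1 : k) ^ (m - n) • poissonBracket n deg F (Q.apply _ G)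

/-- `P` is an `(n-1)`-shifted homotopy Poisson structure on the formal moduli problem `L`. -/
structure IsHomotopyPoisson (L : LInftyAlgebra k deg) (P : PolyVector k n deg) : Prop where
  degree : IsHomogeneous k _ P (n + 1)
  mixedDegree : MixedDegreeGE n deg P 2
  masterEquation :
    schouten n deg (ofVectorField n deg L.Q + P) (ofVectorField n deg L.Q + P) = 0

end Cotangent

end FormalModuli

/-! Everything reduces to one Hamiltonian. With the signs chosen, the differential of `T^*[n]L` is
itself Hamiltonian, generated by `Q_𝔩` read as a function linear in the `p_i`
(`hamiltonianField_ofVectorField`). Hence the twisted field is `Q_H` for `H = Q_𝔩 + Π`, homogeneous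
of degree `n + 1`, and the Schouten bracket is the Poisson bracket of `T^*[n]L`.

The main computation is `hamiltonianField_poissonBracket`: the Hamiltonian field of `{H, F}` is
`[Q_H, Q_F]`. It makes `Q_H` a derivation of the bracket, and for `F = H` it gives `2 Q_H² =
Q_{{H,H}}`. So the master equation implies `Q_H² = 0` because 2 is invertible. Conversely, if `Q_H²
= 0` then nondegeneracy of the Poisson tensor kills all derivatives of `{H, H}`, leaving a constant,
and this constant is zero because `Q_H` vanishes at the origin.

The condition `j ≥ 2` says that all first derivatives of `Π` vanish on the zero section. Therefore
the twist creates no curvature and `Q_H` restricts to `Q_𝔩` there. -/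

namespace FormalModuli

/-! ### Signs and parities. -/

section Sign

variable {k : Type*} [Field k]

/-- The parity condition is put on the sum of the exponents rather than the difference, so that in
most uses `ring` verifies an explicit half of it. -/
theorem neg_one_zpow_congr {a b : ℤ} (h : Even (a + b)) : (-1 : k) ^ a = (-1) ^ b := by
  have h' : Even (a - b) := by
    rw [Int.even_add] at h
    rwa [Int.even_sub]
  have : a = (a - b) + b := by ring
  rw [this, zpow_add₀ (by norm_num), h'.neg_one_zpow, one_mul]

theorem neg_one_zpow_add (a b : ℤ) : (-1 : k) ^ (a + b) = (-1) ^ a * (-1) ^ b :=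
  zpow_add₀ (by norm_num) a b

end Sign

/-! ### The product of Taylor coefficients. -/

section Words

variable {k : Type*} [Field k] {σ : Type*} (deg : σ → ℤ)

@[simp] theorem wordDeg_nil : wordDeg deg [] = 0 := rfl

@[simp] theorem wordDeg_cons (s : σ) (w : List σ) :
    wordDeg deg (s :: w) = coordDeg deg s + wordDeg deg w := by
  simp [wordDeg]

@[simp] theorem wordDeg_append (u v : List σ) :
    wordDeg deg (u ++ v) = wordDeg deg u + wordDeg deg v := by
  simp [wordDeg]

theorem mulWord_add_left (w : List σ) (f f' g : List σ → k) :
    mulWord k deg w (fun u => f u + f' u) g = mulWord k deg w f g + mulWord k deg w f' g := by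
  induction w generalizing f f' g with
  | nil => simp only [mulWord]; ring
  | cons s w ih =>
    simp only [mulWord, mul_add]
    rw [ih, ih]
    ring

theorem mulWord_add_right (w : List σ) (f g g' : List σ → k) :
    mulWord k deg w f (fun u => g u + g' u) = mulWord k deg w f g + mulWord k deg w f g' := by
  induction w generalizing f g g' with
  | nil => simp only [mulWord]; ring
  | cons s w ih =>
    simp only [mulWord]
    rw [ih, ih]
    ring

theorem mulWord_zero_left (w : List σ) (g : List σ → k) :
    mulWord k deg w (fun _ => 0) g = 0 := by
  simpa using mulWord_smul_left deg (0 : k) w (fun _ => 0) g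

theorem mulWord_zero_right (w : List σ) (f : List σ → k) :
    mulWord k deg w f (fun _ => 0) = 0 := by
  simpa using mulWord_smul_right deg (0 : k) w f (fun _ => 0)

theorem twist_cons (m : ℤ) (s : σ) (f : List σ → k) :
    (fun u => (-1 : k) ^ (m * wordDeg deg (s :: u)) * f (s :: u)) =
      fun u => (-1 : k) ^ (m * coordDeg deg s) * ((-1) ^ (m * wordDeg deg u) * f (s :: u)) := by
  funext u
  rw [wordDeg_cons, mul_add, neg_one_zpow_add, mul_assoc]

theorem twist_concat (m : ℤ) (s : σ) (f : List σ → k) :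
    (fun u => (-1 : k) ^ (m * wordDeg deg (u ++ [s])) * f (u ++ [s])) =
      fun u => (-1 : k) ^ (m * coordDeg deg s) * ((-1) ^ (m * wordDeg deg u) * f (u ++ [s])) := by
  funext u
  rw [wordDeg_append, wordDeg_cons, wordDeg_nil, add_zero, mul_add, neg_one_zpow_add]
  ring

theorem twist_comm (m m' : ℤ) (f : List σ → k) :
    (fun u => (-1 : k) ^ (m * wordDeg deg u) * ((-1) ^ (m' * wordDeg deg u) * f u)) =
      fun u => (-1 : k) ^ (m' * wordDeg deg u) * ((-1) ^ (m * wordDeg deg u) * f u) := by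
  funext u; ring

/-- The sign `(-1)^{m d}` is multiplicative because degrees add. Associativity needs this, since the
Leibniz rule twists a whole product. -/
theorem mulWord_twist (m : ℤ) (w : List σ) (f g : List σ → k) :
    mulWord k deg w (fun u => (-1) ^ (m * wordDeg deg u) * f u)
      (fun u => (-1) ^ (m * wordDeg deg u) * g u) =
      (-1) ^ (m * wordDeg deg w) * mulWord k deg w f g := by
  induction w generalizing f g with
  | nil => simp [mulWord]
  | cons s w ih =>
    simp only [mulWord]
    rw [twist_cons, twist_cons, mulWord_smul_left, mulWord_smul_right, ih, twist_comm, ih,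
      wordDeg_cons, mul_add m, neg_one_zpow_add]
    ring

theorem mulWord_assoc (w : List σ) (f g h : List σ → k) :
    mulWord k deg w (fun u => mulWord k deg u f g) h =
      mulWord k deg w f (fun u => mulWord k deg u g h) := by
  induction w generalizing f g h with
  | nil => simp only [mulWord]; ring
  | cons s w ih =>
    simp only [mulWord]
    rw [mulWord_add_left, mulWord_add_right, ih, ih]
    simp only [← mulWord_twist]
    rw [ih]
    ring

theorem mulWord_ne_zero {f g : List σ → k} {m m' : ℤ} (hf : ∀ w, f w ≠ 0 → wordDeg deg w = m)
    (hg : ∀ w, g w ≠ 0 → wordDeg deg w = m') (w : List σ) (h : mulWord k deg w f g ≠ 0) :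
    wordDeg deg w = m + m' := by
  induction w generalizing f g m m' with
  | nil =>
    simp only [mulWord] at h
    rw [← hf [] (left_ne_zero_of_mul h), ← hg [] (right_ne_zero_of_mul h)]
    simp
  | cons s w ih =>
    simp only [mulWord] at h
    rw [wordDeg_cons]
    by_cases h1 : mulWord k deg w (fun u => f (s :: u)) g = 0
    · rw [h1, zero_add] at h
      have := ih (m := m) (m' := m' - coordDeg deg s)
        (fun u hu => hf u (right_ne_zero_of_mul hu))
        (fun u hu => by rw [← hg _ hu, wordDeg_cons]; ring) h
      rw [this]; ring
    · have := ih (m := m - coordDeg deg s) (m' := m')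
        (fun u hu => by rw [← hf _ hu, wordDeg_cons]; ring) hg h1
      rw [this]; ring

theorem twist_eq_of_homogeneous {f : List σ → k} {m : ℤ}
    (hf : ∀ w, f w ≠ 0 → wordDeg deg w = m) (a : ℤ) :
    (fun u => (-1 : k) ^ (a * wordDeg deg u) * f u) = fun u => (-1) ^ (a * m) * f u := by
  funext u
  by_cases h : f u = 0
  · simp [h]
  · rw [hf u h]

/-- Only `f` has to be homogeneous: the Koszul sign is absorbed into a twist of `g`. The degree `m`
varies in the induction because a derivative of `f` has degree `m - |x_s|`. -/
theorem mulWord_comm {f : List σ → k} {m : ℤ} (hf : ∀ w, f w ≠ 0 → wordDeg deg w = m)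
    (g : List σ → k) (w : List σ) :
    mulWord k deg w f g = mulWord k deg w (fun u => (-1) ^ (m * wordDeg deg u) * g u) f := by
  induction w generalizing f g m with
  | nil => simp [mulWord, mul_comm]
  | cons s w ih =>
    simp only [mulWord]
    have h : (fun u => (-1 : k) ^ (coordDeg deg s * wordDeg deg u) *
        ((-1) ^ (m * wordDeg deg u) * g u)) =
        fun u => (-1) ^ ((m - coordDeg deg s) * wordDeg deg u) * g u := by
      funext u
      rw [← mul_assoc, ← neg_one_zpow_add]
      congr 1
      apply neg_one_zpow_congr
      exact ⟨m * wordDeg deg u, by ring⟩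
    rw [twist_eq_of_homogeneous deg hf, mulWord_smul_left, twist_cons, mulWord_smul_left, h,
      ih (m := m - coordDeg deg s) (fun u hu => by rw [← hf _ hu, wordDeg_cons]; ring), ih hf,
      mul_comm m]
    ring

/-- The product is defined by peeling off first letters, that is, by left derivatives. Peeling off
the last letter instead yields the Leibniz rule for right derivatives. -/
theorem mulWord_concat (w : List σ) (s : σ) (f g : List σ → k) :
    mulWord k deg (w ++ [s]) f g = mulWord k deg w f (fun u => g (u ++ [s])) +
      mulWord k deg w (fun u => f (u ++ [s]))
        (fun u => (-1) ^ (coordDeg deg s * wordDeg deg u) * g u) := by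
  induction w generalizing f g with
  | nil => simp [mulWord]; ring
  | cons a w ih =>
    simp only [List.cons_append, mulWord]
    rw [ih, ih, twist_concat, twist_cons, mulWord_smul_left, mulWord_smul_right,
      mul_comm (coordDeg deg a)]
    ring

theorem mulWord_one [DecidableEq σ] (w : List σ) (f : List σ → k) :
    mulWord k deg w f (fun u => if u = [] then 1 else 0) = f w := by
  induction w generalizing f with
  | nil => simp [mulWord]
  | cons s w ih => simp [mulWord, ih, mulWord_zero_right]

theorem one_mulWord [DecidableEq σ] (w : List σ) (f : List σ → k) :
    mulWord k deg w (fun u => if u = [] then 1 else 0) f = f w := by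
  induction w generalizing f with
  | nil => simp [mulWord]
  | cons s w ih =>
    have h : (fun u : List σ => (-1 : k) ^ (coordDeg deg s * wordDeg deg u) *
        (if u = [] then 1 else 0)) = fun u => if u = [] then 1 else 0 := by
      funext u
      split_ifs with hu <;> simp [hu]
    simp only [mulWord]
    rw [h, ih]
    simp [mulWord_zero_left]

/-- The last letter moves to the front by one graded transposition for each letter of `w`. -/
theorem concat_eq_cons {f : List σ → k} (hf : f ∈ Functions k deg) (w : List σ) (s : σ) :
    f (w ++ [s]) = (-1) ^ (coordDeg deg s * wordDeg deg w) * f (s :: w) := by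
  induction w generalizing f with
  | nil => simp
  | cons a w ih =>
    have h1 := ih (cons_mem deg hf a)
    have h2 := hf [] w a s
    simp only [List.nil_append] at h1 h2
    rw [List.cons_append, h1, h2, wordDeg_cons, mul_add, neg_one_zpow_add,
      mul_comm (coordDeg deg a)]
    ring

theorem mulWord_map {τ : Type*} (deg' : τ → ℤ) (e : σ → τ)
    (he : ∀ s, coordDeg deg' (e s) = coordDeg deg s) (w : List σ) (f g : List τ → k) :
    mulWord k deg' (w.map e) f g =
      mulWord k deg w (fun u => f (u.map e)) (fun u => g (u.map e)) := by
  have hw : ∀ u : List σ, wordDeg deg' (u.map e) = wordDeg deg u := by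
    intro u
    induction u with
    | nil => rfl
    | cons a u ih => simp [ih, he]
  induction w generalizing f g with
  | nil => simp [mulWord]
  | cons s w ih => simp only [List.map_cons, mulWord, ih, hw, he]

end Words

/-! ### The graded commutative algebra of functions and its partial derivatives. -/

section Algebra

variable {k : Type*} [Field k] {σ : Type*} {deg : σ → ℤ}

@[ext] theorem Functions.ext {f g : Functions k deg} (h : ∀ w, f.1 w = g.1 w) : f = g :=
  Subtype.ext (funext h)

theorem coe_mul (f g : Functions k deg) (w : List σ) :
    (f * g).1 w = mulWord k deg w f.1 g.1 := rfl

instance : NonUnitalRing (Functions k deg) where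
  left_distrib f g h := Functions.ext fun w => mulWord_add_right deg w f.1 g.1 h.1
  right_distrib f g h := Functions.ext fun w => mulWord_add_left deg w f.1 g.1 h.1
  zero_mul g := Functions.ext fun w => mulWord_zero_left deg w g.1
  mul_zero f := Functions.ext fun w => mulWord_zero_right deg w f.1
  mul_assoc f g h := Functions.ext fun w => mulWord_assoc deg w f.1 g.1 h.1

instance : IsScalarTower k (Functions k deg) (Functions k deg) :=
  ⟨fun c f g => Functions.ext fun w => mulWord_smul_left deg c w f.1 g.1⟩

instance : SMulCommClass k (Functions k deg) (Functions k deg) :=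
  ⟨fun c f g => Functions.ext fun w => (mulWord_smul_right deg c w f.1 g.1).symm⟩

@[simp] theorem Functions.mul_one [DecidableEq σ] (f : Functions k deg) : f * one deg = f :=
  Functions.ext fun w => mulWord_one deg w f.1

@[simp] theorem Functions.one_mul [DecidableEq σ] (f : Functions k deg) : one deg * f = f :=
  Functions.ext fun w => one_mulWord deg w f.1

variable (deg) in
/-- The automorphism of `𝒪(X)` acting on functions of degree `d` by the sign `(-1)^{m d}`. -/
def twist (m : ℤ) (f : Functions k deg) : Functions k deg :=
  ⟨fun u => (-1) ^ (m * wordDeg deg u) * f.1 u, twist_mem deg f.2 m⟩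

theorem twist_twist (m m' : ℤ) (f : Functions k deg) :
    twist deg m (twist deg m' f) = twist deg (m + m') f := by
  ext w
  simp only [twist]
  rw [add_mul, neg_one_zpow_add, mul_assoc]

theorem twist_congr {m m' : ℤ} (h : Even (m + m')) (f : Functions k deg) :
    twist deg m f = twist deg m' f := by
  ext w
  simp only [twist]
  rw [neg_one_zpow_congr (b := m' * wordDeg deg w)]
  rw [← add_mul]
  exact h.mul_right _

theorem IsHomogeneous.twist_eq {f : Functions k deg} {m : ℤ} (hf : IsHomogeneous k deg f m)
    (a : ℤ) : twist deg a f = (-1 : k) ^ (a * m) • f :=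
  Subtype.ext (twist_eq_of_homogeneous deg hf a)

theorem IsHomogeneous.mul_eq {f : Functions k deg} {m : ℤ} (hf : IsHomogeneous k deg f m)
    (g : Functions k deg) : f * g = twist deg m g * f :=
  Functions.ext fun w => mulWord_comm deg hf g.1 w

theorem IsHomogeneous.mul_comm {f g : Functions k deg} {m m' : ℤ}
    (hf : IsHomogeneous k deg f m) (hg : IsHomogeneous k deg g m') :
    f * g = (-1 : k) ^ (m * m') • (g * f) := by
  rw [hf.mul_eq, hg.twist_eq, smul_mul_assoc]

theorem IsHomogeneous.zero (m : ℤ) : IsHomogeneous k deg 0 m := fun _ h => absurd rfl h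

theorem IsHomogeneous.add {f g : Functions k deg} {m : ℤ} (hf : IsHomogeneous k deg f m)
    (hg : IsHomogeneous k deg g m) : IsHomogeneous k deg (f + g) m := by
  intro w h
  by_cases h1 : f.1 w = 0
  · exact hg w fun h2 => h (by change f.1 w + g.1 w = 0; rw [h1, h2, add_zero])
  · exact hf w h1

theorem IsHomogeneous.sum {α : Type*} (S : Finset α) {f : α → Functions k deg} {m : ℤ}
    (hf : ∀ i ∈ S, IsHomogeneous k deg (f i) m) : IsHomogeneous k deg (∑ i ∈ S, f i) m := by
  classical
  induction S using Finset.induction_on with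
  | empty => exact IsHomogeneous.zero m
  | insert a S ha ih =>
    rw [Finset.sum_insert ha]
    exact (hf a (Finset.mem_insert_self a S)).add
      (ih fun i hi => hf i (Finset.mem_insert_of_mem hi))

theorem IsHomogeneous.smul {f : Functions k deg} {m : ℤ} (hf : IsHomogeneous k deg f m) (c : k) :
    IsHomogeneous k deg (c • f) m :=
  fun w h => hf w (right_ne_zero_of_mul (a := c) h)

theorem IsHomogeneous.mul {f g : Functions k deg} {m m' : ℤ} (hf : IsHomogeneous k deg f m)
    (hg : IsHomogeneous k deg g m') : IsHomogeneous k deg (f * g) (m + m') :=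
  fun w h => mulWord_ne_zero deg hf hg w h

theorem IsHomogeneous.lderiv {f : Functions k deg} {m : ℤ} (hf : IsHomogeneous k deg f m)
    (s : σ) : IsHomogeneous k deg (lderiv deg s f) (m - coordDeg deg s) := by
  intro w h
  rw [← hf _ h, wordDeg_cons]
  ring

theorem IsHomogeneous.rderiv {f : Functions k deg} {m : ℤ} (hf : IsHomogeneous k deg f m)
    (s : σ) : IsHomogeneous k deg (rderiv deg s f) (m - coordDeg deg s) := by
  intro w h
  rw [← hf _ h, wordDeg_append, wordDeg_cons, wordDeg_nil]
  ring

theorem isHomogeneous_coord [DecidableEq σ] (s : σ) :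
    IsHomogeneous k deg (coord deg s) (coordDeg deg s) := by
  intro w h
  have : w = [s] := by
    by_contra hw
    exact h (by simp [coord, hw])
  simp [this]

variable (deg) in
/-- The left derivative as a linear map. -/
def lderivLinear (s : σ) : Functions k deg →ₗ[k] Functions k deg where
  toFun := lderiv deg s
  map_add' _ _ := rfl
  map_smul' _ _ := rfl

variable (deg) in
/-- The right derivative as a linear map. -/
def rderivLinear (s : σ) : Functions k deg →ₗ[k] Functions k deg where
  toFun := rderiv deg s
  map_add' _ _ := rfl
  map_smul' _ _ := rfl

theorem lderiv_smul (s : σ) (c : k) (f : Functions k deg) :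
    lderiv deg s (c • f) = c • lderiv deg s f := rfl

theorem lderiv_sum {α : Type*} (S : Finset α) (s : σ) (f : α → Functions k deg) :
    lderiv deg s (∑ i ∈ S, f i) = ∑ i ∈ S, lderiv deg s (f i) :=
  map_sum (lderivLinear deg s) f S

theorem rderiv_add (s : σ) (f g : Functions k deg) :
    rderiv deg s (f + g) = rderiv deg s f + rderiv deg s g := rfl

theorem rderiv_smul (s : σ) (c : k) (f : Functions k deg) :
    rderiv deg s (c • f) = c • rderiv deg s f := rfl

theorem rderiv_sum {α : Type*} (S : Finset α) (s : σ) (f : α → Functions k deg) :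
    rderiv deg s (∑ i ∈ S, f i) = ∑ i ∈ S, rderiv deg s (f i) :=
  map_sum (rderivLinear deg s) f S

theorem lderiv_mul (s : σ) (f g : Functions k deg) :
    lderiv deg s (f * g) =
      lderiv deg s f * g + twist deg (coordDeg deg s) f * lderiv deg s g := rfl

theorem rderiv_mul (s : σ) (f g : Functions k deg) :
    rderiv deg s (f * g) =
      f * rderiv deg s g + rderiv deg s f * twist deg (coordDeg deg s) g :=
  Functions.ext fun w => mulWord_concat deg w s f.1 g.1

theorem lderiv_lderiv (s t : σ) (f : Functions k deg) :
    lderiv deg s (lderiv deg t f) =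
      (-1 : k) ^ (coordDeg deg s * coordDeg deg t) • lderiv deg t (lderiv deg s f) := by
  ext w
  have := f.2 [] w t s
  rw [mul_comm (coordDeg deg t)] at this
  exact this

theorem lderiv_rderiv (s t : σ) (f : Functions k deg) :
    lderiv deg s (rderiv deg t f) = rderiv deg t (lderiv deg s f) := rfl

theorem IsHomogeneous.rderiv_eq {f : Functions k deg} {m : ℤ} (hf : IsHomogeneous k deg f m)
    (s : σ) : FormalModuli.rderiv deg s f =
      (-1 : k) ^ (coordDeg deg s * (m + 1)) • FormalModuli.lderiv deg s f := by
  ext w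
  change f.1 (w ++ [s]) = (-1) ^ (coordDeg deg s * (m + 1)) * f.1 (s :: w)
  rw [concat_eq_cons deg f.2]
  by_cases h : f.1 (s :: w) = 0
  · simp [h]
  · rw [← hf _ h, wordDeg_cons]
    congr 1
    apply neg_one_zpow_congr
    -- With `a = |x_s|`, the exponents `a|w|` and `a(a + |w| + 1)` differ by the even number `a(a +
    -- 1)`.
    have := Int.even_mul_succ_self (coordDeg deg s)
    have h2 : coordDeg deg s * wordDeg deg w +
        coordDeg deg s * (coordDeg deg s + wordDeg deg w + 1) =
        coordDeg deg s * (coordDeg deg s + 1) +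
          (coordDeg deg s * wordDeg deg w + coordDeg deg s * wordDeg deg w) := by ring
    rw [h2]
    exact this.add ⟨_, rfl⟩

theorem lderiv_coord [DecidableEq σ] (s t : σ) :
    lderiv deg s (coord deg t : Functions k deg) = if s = t then one deg else 0 := by
  ext w
  by_cases h : s = t <;> simp [lderiv, coord, one, h]

theorem rderiv_coord [DecidableEq σ] (s t : σ) :
    rderiv deg s (coord deg t : Functions k deg) = if s = t then one deg else 0 := by
  ext w
  by_cases h : s = t
  · simp [rderiv, coord, one, h]
  · have : w ++ [s] ≠ [t] := by
      intro h'
      have h2 := congrArg List.getLast? h'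
      simp at h2
      exact h h2
    simp [rderiv, coord, h, this]

end Algebra

/-! ### Vector fields as derivations, and their commutators. -/

section Derivations

variable {k : Type*} [Field k] {σ : Type*} [Fintype σ] {deg : σ → ℤ}

theorem VectorField.apply_smul (X : VectorField k deg) (c : k) (f : Functions k deg) :
    X.apply deg (c • f) = c • X.apply deg f := by
  simp [VectorField.apply, lderiv_smul, mul_smul_comm, Finset.smul_sum]

theorem VectorField.apply_sum {α : Type*} (X : VectorField k deg) (S : Finset α)
    (f : α → Functions k deg) : X.apply deg (∑ i ∈ S, f i) = ∑ i ∈ S, X.apply deg (f i) := by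
  simp only [VectorField.apply, lderiv_sum, Finset.mul_sum]
  rw [Finset.sum_comm]

theorem VectorField.apply_coord [DecidableEq σ] (X : VectorField k deg) (s : σ) :
    X.apply deg (coord deg s) = X s := by
  simp [VectorField.apply, lderiv_coord]

/-- In each summand, moving `∂_s` and `X^s` past `f` gives a twist by `|x_s| + (|x_s| + m)`, which
has the parity of `m`. -/
theorem VectorField.HasDegree.apply_mul {X : VectorField k deg} {m : ℤ} (hX : X.HasDegree deg m)
    (f g : Functions k deg) :
    X.apply deg (f * g) = X.apply deg f * g + twist deg m f * X.apply deg g := by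
  simp only [VectorField.apply, lderiv_mul, mul_add, Finset.sum_add_distrib, Finset.sum_mul,
    Finset.mul_sum, mul_assoc]
  congr 1
  refine Finset.sum_congr rfl fun s _ => ?_
  rw [← mul_assoc, (hX s).mul_eq, twist_twist, mul_assoc,
    twist_congr (m' := m) ⟨coordDeg deg s + m, by ring⟩]

/-- The graded commutator of `∂_t` with `X` differentiates only the components of `X`; the second
order terms agree up to the Koszul sign. -/
theorem VectorField.HasDegree.apply_lderiv {X : VectorField k deg} (hX : X.HasDegree deg 1)
    (t : σ) (f : Functions k deg) :
    X.apply deg (lderiv deg t f) = (-1 : k) ^ (coordDeg deg t) •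
      (lderiv deg t (X.apply deg f) - ∑ s, lderiv deg t (X s) * lderiv deg s f) := by
  simp only [VectorField.apply, lderiv_sum, lderiv_mul, Finset.sum_add_distrib,
    add_sub_cancel_left, Finset.smul_sum]
  refine Finset.sum_congr rfl fun s _ => ?_
  rw [lderiv_lderiv, (hX s).twist_eq, smul_mul_assoc, mul_smul_comm, smul_smul,
    ← neg_one_zpow_add]
  congr 1
  apply neg_one_zpow_congr
  exact ⟨coordDeg deg t + coordDeg deg t * coordDeg deg s, by ring⟩

/-- A degree `1` vector field `X` and a degree `m` vector field `Y` satisfy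
`X Y = [X, Y] + (-1)^m Y X` as operators on functions. -/
theorem VectorField.HasDegree.apply_apply {X Y : VectorField k deg} {m : ℤ}
    (hX : X.HasDegree deg 1) (hY : Y.HasDegree deg m) (f : Functions k deg) :
    X.apply deg (Y.apply deg f) = (lieBracket deg 1 m X Y).apply deg f +
      (-1 : k) ^ m • Y.apply deg (X.apply deg f) := by
  -- Writing `Y = ∑ Y^t ∂_t` and moving `X` past each `∂_t` confines the second order terms to `Y (X
  -- f)`. The remaining first order terms are those of the commutator.
  have h : X.apply deg (Y.apply deg f) = ∑ t, X.apply deg (Y t) * lderiv deg t f +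
      ∑ t, (-1 : k) ^ m • (Y t * (lderiv deg t (X.apply deg f) -
        ∑ s, lderiv deg t (X s) * lderiv deg s f)) := by
    conv_lhs => rw [VectorField.apply.eq_def deg Y f, VectorField.apply_sum]
    rw [← Finset.sum_add_distrib]
    refine Finset.sum_congr rfl fun t _ => ?_
    rw [hX.apply_mul, hX.apply_lderiv, (hY t).twist_eq, smul_mul_assoc, mul_smul_comm, smul_smul,
      ← neg_one_zpow_add]
    congr 2
    apply neg_one_zpow_congr
    exact ⟨m + coordDeg deg t, by ring⟩
  rw [h]
  simp only [mul_sub, smul_sub, Finset.sum_sub_distrib, Finset.mul_sum]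
  rw [Finset.sum_congr rfl fun t _ => Finset.smul_sum, Finset.sum_comm]
  simp only [lieBracket, VectorField.apply, one_mul, sub_mul, Finset.sum_sub_distrib,
    Finset.smul_sum, Finset.sum_mul, smul_mul_assoc, mul_assoc]
  abel

end Derivations

end FormalModuli

namespace FormalModuli

/-! ### Pullback to the shifted cotangent bundle and restriction to the zero section. -/

section Cotangent

variable {k : Type*} [Field k] {ι : Type*} {n : ℤ} {deg : ι → ℤ}

@[simp] theorem coordDeg_cotangentDeg_inl (i : ι) :
    coordDeg (cotangentDeg n deg) (Sum.inl i) = coordDeg deg i := rfl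

@[simp] theorem coordDeg_cotangentDeg_inr (i : ι) :
    coordDeg (cotangentDeg n deg) (Sum.inr i) = n - coordDeg deg i := by
  simp only [coordDeg, cotangentDeg, Sum.elim_inr]
  ring

theorem pullback_isHomogeneous {f : Functions k deg} {m : ℤ} (hf : IsHomogeneous k deg f m) :
    IsHomogeneous k _ (pullback n deg f) m := by
  intro w h
  have hw : w.all Sum.isLeft = true := by
    by_contra hw
    exact h (by simp only [pullback, if_neg hw])
  simp only [pullback, if_pos hw] at h
  rw [← hf _ h]
  clear h
  induction w with
  | nil => rfl
  | cons a w ih =>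
    rcases a with a | a
    · simp only [List.all_cons, Sum.isLeft_inl, Bool.true_and] at hw
      simp [ih hw]
    · simp at hw

theorem pullback_smul (c : k) (f : Functions k deg) :
    pullback n deg (c • f) = c • pullback n deg f := by
  ext w
  change (if w.all Sum.isLeft then c * f.1 _ else 0) =
    c * (if w.all Sum.isLeft then f.1 _ else 0)
  rw [mul_ite, mul_zero]

theorem rderiv_inl_pullback (i : ι) (f : Functions k deg) :
    rderiv _ (Sum.inl i) (pullback n deg f) = pullback n deg (rderiv deg i f) := by
  ext w
  simp only [rderiv, pullback, List.all_append, List.all_cons, List.all_nil, Sum.isLeft_inl,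
    Bool.and_true, List.filterMap_append, List.filterMap_cons, List.filterMap_nil,
    Sum.getLeft?_inl]

theorem rderiv_inr_pullback (i : ι) (f : Functions k deg) :
    rderiv _ (Sum.inr i) (pullback n deg f) = 0 := by
  ext w
  simp [rderiv, pullback]

theorem zeroSection_pullback (f : Functions k deg) :
    zeroSection n deg (pullback n deg f) = f := by
  ext w
  have h : (w.map (Sum.inl : ι → ι ⊕ ι)).filterMap Sum.getLeft? = w := by
    induction w with
    | nil => rfl
    | cons a w ih => simp [ih]
  simp only [zeroSection, pullback, h]
  simp

theorem zeroSection_mul (F G : PolyVector k n deg) :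
    zeroSection n deg (F * G) = zeroSection n deg F * zeroSection n deg G :=
  Functions.ext fun w => mulWord_map deg (cotangentDeg n deg) Sum.inl (fun _ => rfl) w F.1 G.1

theorem zeroSection_add (F G : PolyVector k n deg) :
    zeroSection n deg (F + G) = zeroSection n deg F + zeroSection n deg G := rfl

variable (k n deg) in
/-- Restriction along the zero section as a linear map. -/
def zeroSectionLinear : PolyVector k n deg →ₗ[k] Functions k deg where
  toFun := zeroSection n deg
  map_add' _ _ := rfl
  map_smul' _ _ := rfl

theorem zeroSection_sum {α : Type*} (S : Finset α) (F : α → PolyVector k n deg) :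
    zeroSection n deg (∑ i ∈ S, F i) = ∑ i ∈ S, zeroSection n deg (F i) :=
  map_sum (zeroSectionLinear k n deg) F S

theorem zeroSection_smul (c : k) (F : PolyVector k n deg) :
    zeroSection n deg (c • F) = c • zeroSection n deg F := rfl

theorem zeroSection_lderiv_inl (i : ι) (F : PolyVector k n deg) :
    zeroSection n deg (lderiv _ (Sum.inl i) F) = lderiv deg i (zeroSection n deg F) := rfl

/-- A word in the `x_i` with one further letter contains at most one `p`, fewer than the two that
`P` requires. -/
theorem MixedDegreeGE.zeroSection_rderiv {P : PolyVector k n deg} (hP : MixedDegreeGE n deg P 2)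
    (s : ι ⊕ ι) : zeroSection n deg (rderiv _ s P) = 0 := by
  ext w
  change P.1 (w.map Sum.inl ++ [s]) = 0
  by_contra h
  have := hP _ h
  rw [List.countP_append, List.countP_map, List.countP_singleton,
    List.countP_eq_zero.2 (by simp)] at this
  split_ifs at this <;> omega

/-- A field whose fibre components vanish on the zero section is tangent to it, so it commutes with
restriction. -/
theorem zeroSection_apply [Fintype ι] {X : VectorField k (cotangentDeg n deg)} {Q : VectorField k deg}
    (hl : ∀ i, zeroSection n deg (X (Sum.inl i)) = Q i)
    (hr : ∀ i, zeroSection n deg (X (Sum.inr i)) = 0) (F : PolyVector k n deg) :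
    zeroSection n deg (X.apply _ F) = Q.apply _ (zeroSection n deg F) := by
  simp only [VectorField.apply, zeroSection_sum, zeroSection_mul]
  simp [Fintype.sum_sum_type, hl, hr, zeroSection_lderiv_inl]

variable [DecidableEq ι]

theorem zeroSection_coord_inr (i : ι) :
    zeroSection n deg (coord (cotangentDeg n deg) (Sum.inr i) : PolyVector k n deg) = 0 := by
  ext w
  simp [zeroSection, coord]

/-! ### The Poisson bracket and Hamiltonian vector fields. -/

theorem poissonTensor_degree {s t : ι ⊕ ι} (h : poissonTensor k n deg s t ≠ 0) :
    coordDeg (cotangentDeg n deg) s + coordDeg (cotangentDeg n deg) t = n := by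
  rcases s with i | i <;> rcases t with j | j <;> simp [poissonTensor] at h ⊢ <;> simp [h]

/-- Graded antisymmetry of the bracket. The signs of the two off-diagonal blocks are compatible
because `(n+1)|x_i| + (n+1)|p_i| = n(n+1)` is even. -/
theorem poissonTensor_swap (s t : ι ⊕ ι) :
    poissonTensor k n deg t s =
      -(-1) ^ ((n + 1) * coordDeg (cotangentDeg n deg) t) * poissonTensor k n deg s t := by
  rcases s with i | i <;> rcases t with j | j <;>
    simp only [poissonTensor, mul_zero, coordDeg_cotangentDeg_inl, coordDeg_cotangentDeg_inr]
  · by_cases h : j = i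
    · subst h
      rw [if_pos rfl, if_pos rfl, neg_mul_neg, ← neg_one_zpow_add, Even.neg_one_zpow]
      rw [← mul_add, sub_add_cancel, mul_comm]
      exact Int.even_mul_succ_self n
    · rw [if_neg h, if_neg (Ne.symm h), mul_zero]
  · by_cases h : j = i
    · subst h
      simp
    · rw [if_neg h, if_neg (Ne.symm h), mul_zero]

/-- Differentiating `{H, F}` produces terms in the second derivatives of `H`. Each is matched here
with a term of `Q_F` applied to a first derivative of `H`. -/
theorem smul_rderiv_rderiv_mul_lderiv {H F : PolyVector k n deg} {m : ℤ}
    (hH : IsHomogeneous k _ H (n + 1)) (hF : IsHomogeneous k _ F m) (q r t : ι ⊕ ι) :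
    poissonTensor k n deg q t • (rderiv _ r (rderiv _ q H) *
        twist _ (coordDeg (cotangentDeg n deg) r) (lderiv _ t F)) =
      -((-1 : k) ^ (m - n) • poissonTensor k n deg t q •
        (rderiv _ t F * lderiv _ q (rderiv _ r H))) := by
  by_cases h : poissonTensor k n deg q t = 0
  · rw [poissonTensor_swap q t, h]
    simp
  have hq := poissonTensor_degree h
  rw [poissonTensor_swap q t, (hF.lderiv t).twist_eq, hF.rderiv_eq t, lderiv_rderiv,
    hH.rderiv_eq q, rderiv_smul, smul_mul_assoc, mul_smul_comm, smul_mul_assoc,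
    (hF.lderiv t).mul_comm ((hH.lderiv q).rderiv r)]
  simp only [smul_smul, ← neg_smul]
  congr 1
  generalize poissonTensor k n deg q t = c
  set a := coordDeg (cotangentDeg n deg) q
  set b := coordDeg (cotangentDeg n deg) t
  set d := coordDeg (cotangentDeg n deg) r
  -- Both sides are now multiples of the product of `∂_q∂_r H` and `∂_t F`, so only their signs
  -- remain. The comparison uses `a + b = n`, available because the tensor entry is nonzero.
  have key : (-1 : k) ^ (a * (n + 1 + 1)) * (-1) ^ (d * (m - b)) =
      (-1) ^ (m - n) * (-1) ^ ((n + 1) * b) * (-1) ^ (b * (m + 1)) *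
        (-1) ^ ((m - b) * (n + 1 - a - d)) := by
    simp only [← neg_one_zpow_add]
    apply neg_one_zpow_congr
    have ha : a = n - b := by omega
    rw [ha]
    by_cases h1 : Even n <;> by_cases h2 : Even m <;> by_cases h3 : Even b <;>
      by_cases h4 : Even d <;> simp [Int.even_add, Int.even_sub, Int.even_mul, h1, h2, h3, h4,
        ← Int.not_even_iff_odd]
  linear_combination c * key

variable [Fintype ι]

theorem schouten_eq_poissonBracket (F G : PolyVector k n deg) :
    schouten n deg F G = poissonBracket n deg F G := by
  simp [schouten, poissonBracket, VectorField.apply, hamiltonianField, Fintype.sum_sum_type,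
    poissonTensor, sub_eq_add_neg, Finset.sum_add_distrib, smul_mul_assoc]

theorem hamiltonianField_add (F G : PolyVector k n deg) :
    hamiltonianField n deg (F + G) = hamiltonianField n deg F + hamiltonianField n deg G := by
  funext t
  simp [hamiltonianField, rderiv_add, Finset.sum_add_distrib]

theorem IsHomogeneous.hamiltonianField {F : PolyVector k n deg} {m : ℤ}
    (hF : IsHomogeneous k _ F m) : (hamiltonianField n deg F).HasDegree _ (m - n) := by
  intro t
  refine IsHomogeneous.sum _ fun s _ => ?_
  by_cases h : poissonTensor k n deg s t = 0
  · rw [h, zero_smul]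
    exact IsHomogeneous.zero _
  · have h1 := (hF.rderiv s).smul (poissonTensor k n deg s t)
    have h2 := poissonTensor_degree h
    have h3 : m - coordDeg (cotangentDeg n deg) s =
        coordDeg (cotangentDeg n deg) t + (m - n) := by omega
    rwa [h3] at h1

/-- The Hamiltonian vector field of `{H, F}` is the commutator of those of `H` and `F`. -/
theorem hamiltonianField_poissonBracket {H F : PolyVector k n deg} {m : ℤ}
    (hH : IsHomogeneous k _ H (n + 1)) (hF : IsHomogeneous k _ F m) :
    hamiltonianField n deg (poissonBracket n deg H F) =
      lieBracket _ 1 (m - n) (hamiltonianField n deg H) (hamiltonianField n deg F) := by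
  funext s
  -- The Leibniz rule splits the derivative of `{H, F}` into `Q_H` applied to `∂_r F` and the second
  -- derivatives of `H`. Contraction with the constant Poisson tensor then commutes with both fields
  -- and gives the commutator.
  have h : ∀ r, rderiv _ r (poissonBracket n deg H F) =
      (hamiltonianField n deg H).apply _ (rderiv _ r F) -
        (-1 : k) ^ (m - n) • (hamiltonianField n deg F).apply _ (rderiv _ r H) := by
    intro r
    simp only [poissonBracket, VectorField.apply, rderiv_sum, rderiv_mul, Finset.sum_add_distrib,
      ← lderiv_rderiv]
    rw [sub_eq_add_neg]
    congr 1
    simp only [hamiltonianField, rderiv_sum, rderiv_smul, Finset.sum_mul, Finset.smul_sum,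
      ← Finset.sum_neg_distrib, smul_mul_assoc]
    rw [Finset.sum_comm]
    refine Finset.sum_congr rfl fun q _ => Finset.sum_congr rfl fun t _ => ?_
    exact smul_rderiv_rderiv_mul_lderiv hH hF q r t
  simp only [lieBracket, one_mul]
  conv_lhs => rw [hamiltonianField]
  simp only [h, smul_sub, Finset.sum_sub_distrib]
  congr 1
  · conv_rhs => rw [hamiltonianField.eq_def n deg F, VectorField.apply_sum]
    simp only [VectorField.apply_smul]
  · conv_rhs => rw [hamiltonianField.eq_def n deg H, VectorField.apply_sum]
    simp only [VectorField.apply_smul, Finset.smul_sum]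
    exact Finset.sum_congr rfl fun r _ => smul_comm _ _ _

/-- This is the Jacobi identity for `{H, ·}`: apply the commutator formula to a function and use
that `Q_H(F)` is `{H, F}` by definition. -/
theorem IsHomogeneous.isSymplectic {H : PolyVector k n deg} (hH : IsHomogeneous k _ H (n + 1)) :
    IsSymplectic n deg (FormalModuli.hamiltonianField n deg H) := by
  intro m F G hF
  have hX : (FormalModuli.hamiltonianField n deg H).HasDegree _ 1 := by
    simpa using hH.hamiltonianField
  rw [poissonBracket, hX.apply_apply hF.hamiltonianField,
    ← hamiltonianField_poissonBracket hH hF]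
  rfl

/-- For `F = H` the sign in the derivation property is `(-1)^{(n+1)-n} = -1`, so the two copies of
`Q_H²` add instead of cancelling. -/
theorem two_smul_hamiltonianField_apply_apply {H : PolyVector k n deg}
    (hH : IsHomogeneous k _ H (n + 1)) (G : PolyVector k n deg) :
    (2 : k) • (hamiltonianField n deg H).apply _ ((hamiltonianField n deg H).apply _ G) =
      poissonBracket n deg (poissonBracket n deg H H) G := by
  have h := hH.isSymplectic (n + 1) H G hH
  simp only [add_sub_cancel_left, zpow_one, neg_smul, one_smul] at h
  rw [two_smul]
  exact add_eq_of_eq_add_neg h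

/-- The Poisson tensor is nondegenerate: it pairs each coordinate with exactly one conjugate
coordinate, with coefficient `±1`. -/
theorem rderiv_eq_zero_of_hamiltonianField_eq_zero {F : PolyVector k n deg}
    (h : hamiltonianField n deg F = 0) (s : ι ⊕ ι) : rderiv _ s F = 0 := by
  rcases s with i | i
  · have := congrFun h (Sum.inr i)
    simp only [hamiltonianField, poissonTensor, Fintype.sum_sum_type, ite_smul, zero_smul,
      Finset.sum_ite_eq', Finset.mem_univ, if_true, Finset.sum_const_zero, add_zero,
      Pi.zero_apply] at this
    exact (smul_eq_zero.1 this).resolve_left (neg_ne_zero.2 (zpow_ne_zero _ (by norm_num)))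
  · have := congrFun h (Sum.inl i)
    simpa [hamiltonianField, poissonTensor, Fintype.sum_sum_type] using this

theorem apply_coeff_nil {σ : Type*} [Fintype σ] {d : σ → ℤ} {X : VectorField k d}
    (hX : ∀ s, (X s).1 [] = 0) (f : Functions k d) : (X.apply d f).1 [] = 0 := by
  simp only [VectorField.apply, AddSubmonoidClass.coe_finsetSum, Finset.sum_apply]
  exact Finset.sum_eq_zero fun s _ => by simp [coe_mul, mulWord, hX s]

/-- A Hamiltonian without linear part has square zero Hamiltonian vector field if and only if it
solves the master equation. -/
theorem squareZero_hamiltonianField_iff [CharZero k] {H : PolyVector k n deg}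
    (hH : IsHomogeneous k _ H (n + 1)) (h0 : ∀ t, (hamiltonianField n deg H t).1 [] = 0) :
    (hamiltonianField n deg H).SquareZero _ ↔ schouten n deg H H = 0 := by
  rw [schouten_eq_poissonBracket]
  constructor
  · intro hsq
    have hz : hamiltonianField n deg (poissonBracket n deg H H) = 0 := by
      funext t
      have h := two_smul_hamiltonianField_apply_apply hH (coord _ t)
      rw [hsq, smul_zero, poissonBracket, VectorField.apply_coord] at h
      exact h.symm
    ext w
    -- The constant term of `{H, H} = Q_H(H)` vanishes because `Q_H` vanishes at the origin; every
    -- other coefficient is a coefficient of some right derivative.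
    rcases List.eq_nil_or_concat w with rfl | ⟨u, s, rfl⟩
    · exact apply_coeff_nil h0 H
    · have := rderiv_eq_zero_of_hamiltonianField_eq_zero hz s
      rw [List.concat_eq_append]
      exact congrFun (congrArg Subtype.val this) u
  · intro hm G
    have h := two_smul_hamiltonianField_apply_apply hH G
    rw [hm] at h
    have h2 : poissonBracket n deg (0 : PolyVector k n deg) G = 0 := by
      have hr : ∀ s, rderiv (cotangentDeg n deg) s (0 : PolyVector k n deg) = 0 := fun _ => rfl
      simp [poissonBracket, VectorField.apply, hamiltonianField, hr]
    rw [h2] at h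
    exact (smul_eq_zero.1 h).resolve_left two_ne_zero

/-! ### Vector fields on `L` as Hamiltonians linear in the fibre coordinates. -/

theorem ofVectorField_isHomogeneous {X : VectorField k deg} {m : ℤ} (hX : X.HasDegree deg m) :
    IsHomogeneous k _ (ofVectorField n deg X) (n + m) := by
  refine IsHomogeneous.sum _ fun i _ => ?_
  have h := (pullback_isHomogeneous (n := n) (hX i)).mul
    (isHomogeneous_coord (k := k) (deg := cotangentDeg n deg) (Sum.inr i))
  rw [coordDeg_cotangentDeg_inr] at h
  convert h using 1
  ring

theorem zeroSection_ofVectorField (X : VectorField k deg) :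
    zeroSection n deg (ofVectorField n deg X) = 0 := by
  simp [ofVectorField, zeroSection_sum, zeroSection_mul, zeroSection_coord_inr]

theorem rderiv_inr_ofVectorField (X : VectorField k deg) (i : ι) :
    rderiv _ (Sum.inr i) (ofVectorField n deg X) = pullback n deg (X i) := by
  simp [ofVectorField, rderiv_sum, rderiv_mul, rderiv_inr_pullback, rderiv_coord]

theorem rderiv_inl_ofVectorField (X : VectorField k deg) (j : ι) :
    rderiv _ (Sum.inl j) (ofVectorField n deg X) =
      ∑ i, (-1 : k) ^ (coordDeg deg j * (n - coordDeg deg i)) •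
        (pullback n deg (rderiv deg j (X i)) * coord _ (Sum.inr i)) := by
  simp [ofVectorField, rderiv_sum, rderiv_mul, rderiv_inl_pullback, rderiv_coord,
    (isHomogeneous_coord _).twist_eq, mul_smul_comm]

/-- Since `∂/∂x_j` has constant components, only its action on the components of `X` survives. -/
theorem lieBracket_coordField {X : VectorField k deg} (j i : ι) :
    lieBracket deg 1 (-coordDeg deg j) X (coordField deg j) i =
      -((-1 : k) ^ coordDeg deg j • lderiv deg j (X i)) := by
  have h1 : X.apply deg (coordField deg j i) = 0 := by
    have : ∀ s, lderiv deg s (coordField deg j i : Functions k deg) = 0 := by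
      intro s
      ext w
      by_cases h : i = j <;> simp [lderiv, coordField, one, h]
    simp [VectorField.apply, this]
  have h2 : (coordField deg j).apply deg (X i) = lderiv deg j (X i) := by
    simp [VectorField.apply, coordField]
  simp only [lieBracket]
  rw [h1, h2, zero_sub, neg_one_zpow_congr (b := coordDeg deg j) ⟨0, by ring⟩]

/-- The differential of `T^*[n]L` is the Hamiltonian vector field of the function `Q`. -/
theorem hamiltonianField_ofVectorField {Q : VectorField k deg} (hQ : Q.HasDegree deg 1) :
    hamiltonianField n deg (ofVectorField n deg Q) = cotangentField n deg Q := by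
  funext t
  rcases t with i | j
  · simp [hamiltonianField, poissonTensor, Fintype.sum_sum_type, cotangentField,
      rderiv_inr_ofVectorField]
  · have h : hamiltonianField n deg (ofVectorField n deg Q) (Sum.inr j) =
        -((-1 : k) ^ ((n + 1) * coordDeg deg j) •
          rderiv _ (Sum.inl j) (ofVectorField n deg Q)) := by
      simp [hamiltonianField, poissonTensor, Fintype.sum_sum_type]
    rw [h, rderiv_inl_ofVectorField]
    simp only [cotangentField, Sum.elim_inr, ofVectorField, Finset.smul_sum,
      ← Finset.sum_neg_distrib]
    refine Finset.sum_congr rfl fun i _ => ?_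
    rw [lieBracket_coordField, (hQ i).rderiv_eq, ← neg_smul, ← neg_smul, pullback_smul, pullback_smul,
      smul_mul_assoc, smul_mul_assoc, smul_smul, smul_smul, neg_mul]
    congr 1
    rw [← neg_one_zpow_add, neg_mul, ← neg_one_zpow_add]
    congr 1
    -- The tensor contributes `(n+1)|x_j|`, passing `p_i` contributes `|x_j|(n-|x_i|)`, and turning
    -- a right into a left derivative contributes `|x_j|(|x_i|+2)`. The total `(2n+3)|x_j|` has the
    -- parity of `|x_j|`, the exponent in the commutator.
    apply neg_one_zpow_congr
    by_cases h1 : Even n <;> by_cases h2 : Even (coordDeg deg i) <;>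
      by_cases h3 : Even (coordDeg deg j) <;>
      simp [Int.even_add, Int.even_sub, Int.even_mul, h1, h2, h3]

/-- The `x`-components have no constant term by the absence of curvature in `Q`; the `p`-components
are linear in the `p_i`, hence zero on the zero section and at its origin. -/
theorem cotangentField_coeff_nil {Q : VectorField k deg} (hQ : ∀ i, (Q i).1 [] = 0)
    (t : ι ⊕ ι) : (cotangentField n deg Q t).1 [] = 0 := by
  rcases t with i | j
  · simp [cotangentField, pullback, hQ]
  · exact congrFun (congrArg Subtype.val (zeroSection_ofVectorField (n := n) _)) []

theorem MixedDegreeGE.zeroSection_hamiltonianField {P : PolyVector k n deg}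
    (hP : MixedDegreeGE n deg P 2) (t : ι ⊕ ι) :
    zeroSection n deg (hamiltonianField n deg P t) = 0 := by
  simp only [hamiltonianField, zeroSection_sum, zeroSection_smul, hP.zeroSection_rderiv, smul_zero,
    Finset.sum_const_zero]

end Cotangent

end FormalModuli

/-! ### The twisted cotangent bundle. -/

theorem mainTheorem5 {k : Type*} [Field k] [CharZero k] {ι : Type*} [Fintype ι] [DecidableEq ι]
    (deg : ι → ℤ) (L : FormalModuli.LInftyAlgebra k deg) (n : ℤ)
    (P : FormalModuli.PolyVector k n deg)
    (hdeg : FormalModuli.IsHomogeneous k (FormalModuli.cotangentDeg n deg) P (n + 1))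
    (hmixed : FormalModuli.MixedDegreeGE n deg P 2) :
    (FormalModuli.VectorField.SquareZero (FormalModuli.cotangentDeg n deg)
        (FormalModuli.cotangentField n deg L.Q + FormalModuli.hamiltonianField n deg P) ↔
      FormalModuli.IsHomotopyPoisson n deg L P) ∧
    (FormalModuli.IsHomotopyPoisson n deg L P →
      ∃ T : FormalModuli.LInftyAlgebra k (FormalModuli.cotangentDeg n deg),
        T.Q = FormalModuli.cotangentField n deg L.Q + FormalModuli.hamiltonianField n deg P ∧
        FormalModuli.IsSymplectic n deg T.Q ∧
        ∀ F : FormalModuli.PolyVector k n deg,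
          FormalModuli.zeroSection n deg (T.Q.apply _ F) =
            L.Q.apply _ (FormalModuli.zeroSection n deg F)) := by
  open FormalModuli in
  have hH : IsHomogeneous k _ (ofVectorField n deg L.Q + P) (n + 1) :=
    (ofVectorField_isHomogeneous L.hasDegree).add hdeg
  -- The twisted field has the single Hamiltonian `Q_𝔩 + Π`, so the square zero criterion and the
  -- symplectic property both apply to it.
  have hV : cotangentField n deg L.Q + hamiltonianField n deg P =
      hamiltonianField n deg (ofVectorField n deg L.Q + P) := by
    rw [hamiltonianField_add, hamiltonianField_ofVectorField L.hasDegree]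
  have h0 : ∀ t, ((cotangentField n deg L.Q + hamiltonianField n deg P) t).1 [] = 0 := by
    intro t
    have h1 := cotangentField_coeff_nil (n := n) L.noCurvature t
    have h2 : (hamiltonianField n deg P t).1 [] = 0 :=
      congrFun (congrArg Subtype.val (hmixed.zeroSection_hamiltonianField t)) []
    change (cotangentField n deg L.Q t).1 [] + (hamiltonianField n deg P t).1 [] = 0
    rw [h1, h2, add_zero]
  have hiff : (cotangentField n deg L.Q + hamiltonianField n deg P).SquareZero _ ↔
      IsHomotopyPoisson n deg L P := by
    rw [hV, squareZero_hamiltonianField_iff hH (hV ▸ h0)]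
    exact ⟨fun h => ⟨hdeg, hmixed, h⟩, fun h => h.masterEquation⟩
  refine ⟨hiff, fun hP => ⟨⟨_, ?_, h0, hiff.2 hP⟩, rfl, ?_, ?_⟩⟩
  · rw [hV]
    simpa using hH.hamiltonianField
  · have hs := hH.isSymplectic
    rwa [← hV] at hs
  · refine zeroSection_apply (fun i => ?_) (fun i => ?_)
    · change zeroSection n deg (cotangentField n deg L.Q (Sum.inl i) +
        hamiltonianField n deg P (Sum.inl i)) = L.Q i
      rw [zeroSection_add, hmixed.zeroSection_hamiltonianField, add_zero]
      exact zeroSection_pullback _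
    · change zeroSection n deg (cotangentField n deg L.Q (Sum.inr i) +
        hamiltonianField n deg P (Sum.inr i)) = 0
      rw [zeroSection_add, hmixed.zeroSection_hamiltonianField, add_zero]
      exact zeroSection_ofVectorField _
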